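/- For every integer $d \ge 2$ there exist a line $\ell$ in $\mathbb{R}^d$ and a finite family of pairwise disjoint congruent closed balls $B_1,\dots,B_n$ of positive radius in $\mathbb{R}^d$ that is a stable pinning of $\ell$ by balls tangent to $\ell$. Here a family $\mathcal F$ of sets pins $\ell$ if $\ell$ is an isolated point of the space of line transversals to $\mathcal F$, that is, of the set of all lines meeting every member of $\mathcal F$, as a subspace of the affine Grassmannian of lines in $\mathbb{R}^d$. A pinning of $\ell$ by disjoint balls $B_1,\dots,B_n$ is stable if there is an $\varepsilon>0$ such that every family of balls $B'_1,\dots,B'_n$ of positive radius, in which each $B'_i$ is tangent to $\ell$ and the center of $B'_i$ has distance at most $\varepsilon$ from the center of $B_i$, also pins $\ell$. -/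

import Mathlib

open Module

namespace Pinning

/-- A line in `ℝ^d`: a one-dimensional affine subspace (such a subspace is nonempty, since the
empty one has direction `⊥`). -/
@[ext]
structure Line (d : ℕ) where
  /-- the underlying affine subspace -/
  toAffine : AffineSubspace ℝ (EuclideanSpace ℝ (Fin d))
  /-- the direction is one-dimensional -/
  finrank_direction : finrank ℝ toAffine.direction = 1

/-- The set of points of a line. -/
def Line.points {d : ℕ} (l : Line d) : Set (EuclideanSpace ℝ (Fin d)) :=
  (l.toAffine : Set (EuclideanSpace ℝ (Fin d)))

/-- The line `{p + t v : t ∈ ℝ}` given by a point `p` and a nonzero direction vector `v`. -/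
noncomputable def Line.through {d : ℕ}
    (x : EuclideanSpace ℝ (Fin d) × {v : EuclideanSpace ℝ (Fin d) // v ≠ 0}) : Line d where
  toAffine := AffineSubspace.mk' x.1 (Submodule.span ℝ {(x.2 : EuclideanSpace ℝ (Fin d))})
  finrank_direction := by
    rw [AffineSubspace.direction_mk']
    exact finrank_span_singleton x.2.2

/-- The affine Grassmannian of lines in `ℝ^d` carries its usual topology, the quotient topology of
the space of pairs (point, nonzero direction vector). -/
noncomputable instance instTopologicalSpaceLine {d : ℕ} : TopologicalSpace (Line d) :=
  TopologicalSpace.coinduced Line.through inferInstance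

/-- The space of transversals to a family of sets: the lines that meet every member. -/
def transversals {d : ℕ} {ι : Type*} (F : ι → Set (EuclideanSpace ℝ (Fin d))) : Set (Line d) :=
  {l | ∀ i, (l.points ∩ F i).Nonempty}

/-- The family `F` pins `l` if `l` is an isolated point of the space of transversals to `F`. -/
def Pins {d : ℕ} {ι : Type*} (F : ι → Set (EuclideanSpace ℝ (Fin d))) (l : Line d) : Prop :=
  ∃ U : Set (Line d), IsOpen U ∧ U ∩ transversals F = {l}

/-- The ball with center `c` and radius `r` is tangent to `l`: it has positive radius, and the
distance from its center to `l` equals its radius. -/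
def IsTangentBall {d : ℕ} (c : EuclideanSpace ℝ (Fin d)) (r : ℝ) (l : Line d) : Prop :=
  0 < r ∧ Metric.infDist c l.points = r

/-- The closed balls with centers `c i` and radii `r i` form a stable pinning of `l`: they are
pairwise disjoint, tangent to `l` and pin `l`, and for some `ε > 0` every family of balls that are
tangent to `l` and have centers at distance at most `ε` from the original ones also pins `l`.
The radius of a perturbed ball is determined by its center through the tangency. -/
structure IsStablePinning {d n : ℕ} (c : Fin n → EuclideanSpace ℝ (Fin d)) (r : Fin n → ℝ)
    (l : Line d) : Prop where
  disjoint : ∀ i j, i ≠ j → Disjoint (Metric.closedBall (c i) (r i)) (Metric.closedBall (c j) (r j))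
  tangent : ∀ i, IsTangentBall (c i) (r i) l
  pins : Pins (fun i => Metric.closedBall (c i) (r i)) l
  stable : ∃ ε : ℝ, 0 < ε ∧
    ∀ (c' : Fin n → EuclideanSpace ℝ (Fin d)) (r' : Fin n → ℝ),
      (∀ i, dist (c' i) (c i) ≤ ε ∧ IsTangentBall (c' i) (r' i) l) →
        Pins (fun i => Metric.closedBall (c' i) (r' i)) l

end Pinning

open scoped RealInnerProductSpace

/-! Lines near the axis `ℝe` are `u + z (e + v)` with `u, v ⊥ e`. Meeting a ball tangent to the axis
forces `firstOrder e c (u, v)` to be nonnegative up to an error quadratic in `v`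
(`neg_sq_le_firstOrder`). If the linear system `firstOrder ≥ 0` has only the zero solution,
compactness of the unit sphere gives a violation of at least `κ`, uniformly for nearby centers
(`exists_uniform_firstOrder_lt`). This beats the quadratic error, so the axis is isolated
(`pins_axis_of_firstOrder`), and stability comes for free. Such a system arises from `3 (d - 1)`
unit balls: in each coordinate orthogonal to the axis, three balls on alternating sides make an
affine function of height `≥ 0`, `≤ 0`, `≥ 0` at equally spaced points, hence zero. -/

namespace Pinning

/-! ### Linearized tangency constraints -/

section FirstOrder

variable {E : Type*} [NormedAddCommGroup E] [InnerProductSpace ℝ E]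

/-- The derivative, at the axis spanned by the unit vector `e`, of the constraint which a ball with
center `c` tangent to the axis imposes on the lines `{u + z (e + v)}` with `u, v ⊥ e`. -/
noncomputable def firstOrder (e c : E) (x : E × E) : ℝ := ⟪c, x.1⟫ + ⟪e, c⟫ * ⟪c, x.2⟫

theorem firstOrder_smul (e c : E) (t : ℝ) (x : E × E) :
    firstOrder e c (t • x) = t * firstOrder e c x := by
  simp only [firstOrder, Prod.smul_fst, Prod.smul_snd, inner_smul_right]
  ring

/-- Square the distance inequality and complete the square in `z`: the terms left over are `2 *
firstOrder` and `⟪c, v⟫ ^ 2`, the latter bounded by Cauchy–Schwarz. The error does not involve `u`,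
so only the slope need be small. -/
theorem neg_sq_le_firstOrder {e u v c : E} (he : ‖e‖ = 1) (hu : ⟪e, u⟫ = 0) (hv : ⟪e, v⟫ = 0)
    {z : ℝ} (h : ‖u + z • (e + v) - c‖ ≤ ‖c - ⟪e, c⟫ • e‖) :
    -(‖c‖ ^ 2 * ‖v‖ ^ 2) ≤ 2 * firstOrder e c (u, v) := by
  have hee : ⟪e, e⟫ = 1 := by rw [real_inner_self_eq_norm_sq, he]; norm_num
  have h1 : ‖u + z • (e + v) - c‖ ^ 2 = ‖u + z • v‖ ^ 2 + z ^ 2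
      - 2 * (⟪c, u⟫ + z * ⟪e, c⟫ + z * ⟪c, v⟫) + ‖c‖ ^ 2 := by
    simp only [← real_inner_self_eq_norm_sq, inner_add_left, inner_add_right, inner_sub_left,
      inner_sub_right, inner_smul_left, inner_smul_right, hee, hu, hv, real_inner_comm e u,
      real_inner_comm e v, real_inner_comm c u, real_inner_comm c v, real_inner_comm e c,
      RCLike.conj_to_real]
    ring
  have h2 : ‖c - ⟪e, c⟫ • e‖ ^ 2 = ‖c‖ ^ 2 - ⟪e, c⟫ ^ 2 := by
    simp only [← real_inner_self_eq_norm_sq, inner_sub_left,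
      inner_sub_right, inner_smul_left, inner_smul_right, hee, real_inner_comm e c,
      RCLike.conj_to_real]
    ring
  have h3 := pow_le_pow_left₀ (norm_nonneg _) h 2
  have h4 : ⟪c, v⟫ ^ 2 ≤ ‖c‖ ^ 2 * ‖v‖ ^ 2 := by
    rw [← mul_pow, ← sq_abs]
    exact pow_le_pow_left₀ (abs_nonneg _) (abs_real_inner_le_norm c v) 2
  rw [h1, h2] at h3
  simp only [firstOrder]
  nlinarith [sq_nonneg (z - ⟪e, c⟫ - ⟪c, v⟫), sq_nonneg ‖u + z • v‖]

/-- If the first-order constraints have only the trivial solution, then so have, quantitatively,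
all nearby systems. -/
theorem exists_uniform_firstOrder_lt [FiniteDimensional ℝ E] {ι : Type*} [Fintype ι] (e : E)
    (c : ι → E)
    (h : ∀ u v : E, ⟪e, u⟫ = 0 → ⟪e, v⟫ = 0 → (∀ i, 0 ≤ firstOrder e (c i) (u, v)) →
      u = 0 ∧ v = 0) :
    ∃ ε > 0, ∃ κ > 0, ∀ c' : ι → E, (∀ i, dist (c' i) (c i) ≤ ε) →
      ∀ x : E × E, ‖x‖ = 1 → ⟪e, x.1⟫ = 0 → ⟪e, x.2⟫ = 0 →
        ∃ i, firstOrder e (c' i) x < -κ := by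
  have hcomp : IsCompact {x : E × E | ‖x‖ = 1 ∧ ⟪e, x.1⟫ = 0 ∧ ⟪e, x.2⟫ = 0} := by
    have := FiniteDimensional.proper ℝ (E × E)
    refine (isCompact_sphere (0 : E × E) 1).of_isClosed_subset ?_ ?_
    · exact (isClosed_eq (by fun_prop) (by fun_prop)).inter
        ((isClosed_eq (by fun_prop) (by fun_prop)).inter
          (isClosed_eq (by fun_prop) (by fun_prop)))
    · intro x hx
      simpa using hx.1
  -- Treating the threshold as a further parameter near `0` yields `ε` and `κ` from one compactness
  -- argument.
  have hev : ∀ᶠ p : (ι → E) × ℝ in nhds (c, 0),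
      ∀ x ∈ {x : E × E | ‖x‖ = 1 ∧ ⟪e, x.1⟫ = 0 ∧ ⟪e, x.2⟫ = 0},
        ∃ i, firstOrder e (p.1 i) x < -p.2 := by
    refine hcomp.eventually_forall_of_forall_eventually ?_
    rintro ⟨u, v⟩ ⟨hx, hu, hv⟩
    have : ∃ i, firstOrder e (c i) (u, v) < 0 := by
      by_contra! hcon
      obtain ⟨rfl, rfl⟩ := h u v hu hv hcon
      simp at hx
    obtain ⟨i, hi⟩ := this
    have hopen : IsOpen {y : ((ι → E) × ℝ) × (E × E) | firstOrder e (y.1.1 i) y.2 < -y.1.2} := by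
      unfold firstOrder
      exact isOpen_lt (by fun_prop) (by fun_prop)
    filter_upwards [hopen.mem_nhds (x := ((c, 0), (u, v))) (by simpa using hi)] with y hy
    exact ⟨i, hy⟩
  obtain ⟨δ, hδ, hball⟩ := Metric.eventually_nhds_iff.1 hev
  refine ⟨δ / 2, half_pos hδ, δ / 2, half_pos hδ, fun c' hc' x hx hu hv => ?_⟩
  refine hball (y := (c', δ / 2)) ?_ x ⟨hx, hu, hv⟩
  rw [Prod.dist_eq, max_lt_iff]
  constructor
  · exact ((dist_pi_le_iff (half_pos hδ).le).2 hc').trans_lt (half_lt_self hδ)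
  · simp only [dist_zero_right, Real.norm_eq_abs, abs_of_pos (half_pos hδ)]
    exact half_lt_self hδ

end FirstOrder

/-! ### Lines near the axis -/

section Lines

variable {d : ℕ}

/-- The line through the origin spanned by a unit vector. -/
noncomputable def axis (e : EuclideanSpace ℝ (Fin d)) (he : ‖e‖ = 1) : Line d :=
  Line.through (0, ⟨e, fun h => by simp [h] at he⟩)

theorem mem_axis {e : EuclideanSpace ℝ (Fin d)} {he : ‖e‖ = 1} {q : EuclideanSpace ℝ (Fin d)} :
    q ∈ (axis e he).points ↔ ∃ t : ℝ, t • e = q := by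
  simp [Line.points, axis, Line.through, Submodule.mem_span_singleton, AffineSubspace.mem_mk']

/-- The lines whose slope with respect to `e` is less than `δ`. -/
def slopeLT (e : EuclideanSpace ℝ (Fin d)) (δ : ℝ) : Set (Line d) :=
  {m | ∀ x ∈ m.toAffine.direction, x ≠ 0 → ‖x - ⟪e, x⟫ • e‖ < δ * |⟪e, x⟫|}

theorem isOpen_slopeLT (e : EuclideanSpace ℝ (Fin d)) (δ : ℝ) : IsOpen (slopeLT e δ) := by
  rw [isOpen_coinduced]
  have : Line.through ⁻¹' slopeLT e δ =
      {x | ‖(x.2 : EuclideanSpace ℝ (Fin d)) - ⟪e, x.2⟫ • e‖ < δ * |⟪e, x.2⟫|} := by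
    ext ⟨p, v, hv⟩
    simp only [slopeLT, Line.through, Set.mem_preimage, Set.mem_ofPred_eq,
      AffineSubspace.direction_mk']
    constructor
    · exact fun h => h v (Submodule.mem_span_singleton_self v) hv
    · intro h x hx hx0
      obtain ⟨t, rfl⟩ := Submodule.mem_span_singleton.1 hx
      have ht : t ≠ 0 := fun ht => hx0 (by simp [ht])
      rw [inner_smul_right, mul_smul, ← smul_sub, norm_smul, abs_mul, Real.norm_eq_abs]
      nlinarith [mul_lt_mul_of_pos_left h (abs_pos.2 ht)]
  rw [this]
  exact isOpen_lt (by fun_prop) (by fun_prop)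

theorem axis_mem_slopeLT {e : EuclideanSpace ℝ (Fin d)} {he : ‖e‖ = 1} {δ : ℝ} (hδ : 0 < δ) :
    axis e he ∈ slopeLT e δ := by
  intro x hx hx0
  simp only [axis, Line.through, AffineSubspace.direction_mk'] at hx
  obtain ⟨t, rfl⟩ := Submodule.mem_span_singleton.1 hx
  have ht : t ≠ 0 := fun ht => hx0 (by simp [ht])
  have hin : ⟪e, t • e⟫ = t := by
    rw [inner_smul_right, real_inner_self_eq_norm_sq, he]; ring
  rw [hin, sub_self, norm_zero]
  exact mul_pos hδ (abs_pos.2 ht)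

/-- A line of finite slope is parametrized by `u + z (e + v)` with `u, v ⊥ e`. -/
theorem exists_param_of_mem_slopeLT {e : EuclideanSpace ℝ (Fin d)} (he : ‖e‖ = 1) {δ : ℝ}
    {m : Line d} (hm : m ∈ slopeLT e δ) :
    ∃ u v : EuclideanSpace ℝ (Fin d), ⟪e, u⟫ = 0 ∧ ⟪e, v⟫ = 0 ∧ ‖v‖ < δ ∧
      m.toAffine = AffineSubspace.mk' u (Submodule.span ℝ {e + v}) := by
  have hee : ⟪e, e⟫ = 1 := by rw [real_inner_self_eq_norm_sq, he]; norm_num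
  obtain ⟨⟨x, hx⟩, hx0, hspan⟩ := finrank_eq_one_iff'.1 m.finrank_direction
  have hx0' : x ≠ 0 := fun h => hx0 (by ext1; exact h)
  have hslope := hm x hx hx0'
  have hex : ⟪e, x⟫ ≠ 0 := by
    intro h
    rw [h] at hslope
    simp at hslope
    exact absurd hslope (not_lt.2 (norm_nonneg _))
  have hne : (m.toAffine : Set (EuclideanSpace ℝ (Fin d))).Nonempty := by
    rw [Set.nonempty_iff_ne_empty]
    intro h
    have h0 := m.finrank_direction
    rw [(AffineSubspace.coe_eq_bot_iff _).1 h, AffineSubspace.direction_bot, finrank_bot] at h0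
    exact zero_ne_one h0
  obtain ⟨p, hp⟩ := hne
  have hdir : m.toAffine.direction = Submodule.span ℝ {x} := by
    apply le_antisymm
    · intro y hy
      obtain ⟨t, ht⟩ := hspan ⟨y, hy⟩
      exact Submodule.mem_span_singleton.2 ⟨t, congrArg Subtype.val ht⟩
    · rwa [Submodule.span_singleton_le_iff_mem]
  have hv : e + ((⟪e, x⟫)⁻¹ • x - e) = (⟪e, x⟫)⁻¹ • x := by abel
  -- `u` is the point where the line crosses the hyperplane `e^⊥`; `e + v` is the direction rescaled
  -- to have `e`-component `1`.
  refine ⟨p - (⟪e, p⟫ * (⟪e, x⟫)⁻¹) • x, (⟪e, x⟫)⁻¹ • x - e, ?_, ?_, ?_, ?_⟩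
  · rw [inner_sub_right, inner_smul_right]; field_simp; ring
  · rw [inner_sub_right, inner_smul_right, hee]; field_simp; ring
  · have : (⟪e, x⟫)⁻¹ • x - e = (⟪e, x⟫)⁻¹ • (x - ⟪e, x⟫ • e) := by
      rw [smul_sub, smul_smul, inv_mul_cancel₀ hex, one_smul]
    rw [this, norm_smul, norm_inv, Real.norm_eq_abs, inv_mul_lt_iff₀ (abs_pos.2 hex)]
    linarith
  · rw [hv, Submodule.span_singleton_smul_eq (IsUnit.mk0 _ (inv_ne_zero hex)), ← hdir]
    refine (AffineSubspace.mk'_eq ?_).symm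
    rw [sub_eq_neg_add, ← neg_smul]
    exact AffineSubspace.vadd_mem_of_mem_direction (Submodule.smul_mem _ _ hx) hp

theorem infDist_axis_le {e : EuclideanSpace ℝ (Fin d)} {he : ‖e‖ = 1}
    (c : EuclideanSpace ℝ (Fin d)) :
    Metric.infDist c (axis e he).points ≤ ‖c - ⟪e, c⟫ • e‖ := by
  rw [← dist_eq_norm]
  exact Metric.infDist_le_dist_of_mem (mem_axis.2 ⟨_, rfl⟩)

theorem axis_meets_of_isTangentBall {e : EuclideanSpace ℝ (Fin d)} {he : ‖e‖ = 1}
    {c : EuclideanSpace ℝ (Fin d)} {r : ℝ} (h : IsTangentBall c r (axis e he)) :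
    ((axis e he).points ∩ Metric.closedBall c r).Nonempty := by
  have hcl : IsClosed (axis e he).points :=
    AffineSubspace.closed_of_finiteDimensional (axis e he).toAffine
  have hne : (axis e he).points.Nonempty := ⟨_, mem_axis.2 ⟨0, rfl⟩⟩
  obtain ⟨q, hq, hd⟩ := hcl.exists_infDist_eq_dist hne c
  refine ⟨q, hq, Metric.mem_closedBall.2 ?_⟩
  rw [dist_comm, ← hd]
  exact h.2.le

/-- First-order pinning: if the linearized constraints are violated in every direction, tangent
balls pin the axis. -/
theorem pins_axis_of_firstOrder {ι : Type*} [Fintype ι] {e : EuclideanSpace ℝ (Fin d)}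
    (he : ‖e‖ = 1) (c : ι → EuclideanSpace ℝ (Fin d)) (r : ι → ℝ)
    (ht : ∀ i, IsTangentBall (c i) (r i) (axis e he)) {κ : ℝ} (hκ : 0 < κ)
    (h : ∀ x : EuclideanSpace ℝ (Fin d) × EuclideanSpace ℝ (Fin d), ‖x‖ = 1 → ⟪e, x.1⟫ = 0 →
      ⟪e, x.2⟫ = 0 → ∃ i, firstOrder e (c i) x < -κ) :
    Pins (fun i => Metric.closedBall (c i) (r i)) (axis e he) := by
  obtain ⟨K, hKpos, hcK⟩ : ∃ K : ℝ, 0 < K ∧ ∀ i, ‖c i‖ ^ 2 ≤ K := by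
    obtain ⟨M, hM⟩ := (Set.finite_range fun i => ‖c i‖ ^ 2).bddAbove
    exact ⟨max M 1, lt_max_of_lt_right one_pos,
      fun i => (hM (Set.mem_range_self i)).trans (le_max_left _ _)⟩
  -- With `‖v‖ < 2 * κ / K`, the error `K * ‖v‖ ^ 2` stays below `2 * κ * ‖(u, v)‖`, the violation
  -- after rescaling from the unit sphere.
  have hδ : 0 < 2 * κ / K := by positivity
  refine ⟨slopeLT e (2 * κ / K), isOpen_slopeLT e _, ?_⟩
  ext m
  rw [Set.mem_singleton_iff]
  constructor
  · rintro ⟨hm, htr⟩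
    obtain ⟨u, v, hu, hv, hvδ, hmeq⟩ := exists_param_of_mem_slopeLT he hm
    have hlow : ∀ i, -(K * ‖v‖ ^ 2) ≤ 2 * firstOrder e (c i) (u, v) := by
      intro i
      obtain ⟨q, hq, hqc⟩ := htr i
      rw [Line.points, hmeq, SetLike.mem_coe, AffineSubspace.mem_mk',
        Submodule.mem_span_singleton] at hq
      obtain ⟨z, hz⟩ := hq
      have hq' : u + z • (e + v) = q := by rw [hz, vsub_eq_sub]; abel
      have := neg_sq_le_firstOrder he hu hv (z := z) (c := c i) (by
        rw [hq', ← dist_eq_norm]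
        exact (Metric.mem_closedBall.1 hqc).trans ((ht i).2 ▸ infDist_axis_le (c i)))
      nlinarith [mul_le_mul_of_nonneg_right (hcK i) (sq_nonneg ‖v‖)]
    have hzero : (u, v) = (0 : EuclideanSpace ℝ (Fin d) × EuclideanSpace ℝ (Fin d)) := by
      by_contra hne
      have hpos := norm_pos_iff.2 hne
      obtain ⟨i, hi⟩ := h (‖(u, v)‖⁻¹ • (u, v)) (norm_smul_inv_norm (𝕜 := ℝ) hne)
        (by rw [Prod.smul_fst, inner_smul_right, hu, mul_zero])
        (by rw [Prod.smul_snd, inner_smul_right, hv, mul_zero])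
      rw [firstOrder_smul, inv_mul_lt_iff₀ hpos] at hi
      have hvle : ‖v‖ ≤ ‖(u, v)‖ := norm_snd_le (u, v)
      rw [lt_div_iff₀ hKpos] at hvδ
      nlinarith [hlow i, mul_le_mul_of_nonneg_left hvle (mul_nonneg hKpos.le (norm_nonneg v)),
        mul_lt_mul_of_pos_right hvδ hpos]
    obtain ⟨rfl, rfl⟩ := Prod.mk_eq_zero.1 hzero
    apply Line.ext
    rw [hmeq, add_zero]
    rfl
  · rintro rfl
    exact ⟨axis_mem_slopeLT hδ, fun i => axis_meets_of_isTangentBall (ht i)⟩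

end Lines

/-! ### The explicit balls -/

section Configuration

variable {m : ℕ}

/-- The axis of the configuration. -/
noncomputable def baseVector (m : ℕ) : EuclideanSpace ℝ (Fin (m + 1)) := EuclideanSpace.single 0 1

theorem norm_baseVector (m : ℕ) : ‖baseVector m‖ = 1 := by simp [baseVector]

/-- The side, `+`, `-`, `+`, on which the three balls of a triple touch the axis. -/
def side (k : Fin 3) : ℝ := ![1, -1, 1] k

theorem side_sq (k : Fin 3) : side k * side k = 1 := by
  fin_cases k <;> simp [side]

/-- The height `3 i` of the `i`-th center along the axis. -/
def height (p : Fin m × Fin 3) : ℝ := 3 * ((finProdFinEquiv p : Fin (m * 3)) : ℕ)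

theorem height_eq (p : Fin m × Fin 3) : height p = 3 * ((p.2 : ℕ) + 3 * (p.1 : ℕ)) := by
  simp [height, finProdFinEquiv]

/-- For each coordinate direction orthogonal to the axis, three unit balls at equally spaced
heights touch the axis from alternating sides. -/
noncomputable def centerOf (p : Fin m × Fin 3) : EuclideanSpace ℝ (Fin (m + 1)) :=
  EuclideanSpace.single 0 (height p) + EuclideanSpace.single p.1.succ (side p.2)

theorem inner_baseVector (x : EuclideanSpace ℝ (Fin (m + 1))) : ⟪baseVector m, x⟫ = x 0 := by
  simp [baseVector, EuclideanSpace.inner_single_left]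

theorem centerOf_zero (p : Fin m × Fin 3) : centerOf p 0 = height p := by
  simp [centerOf]

theorem inner_centerOf (p : Fin m × Fin 3) (x : EuclideanSpace ℝ (Fin (m + 1))) :
    ⟪centerOf p, x⟫ = height p * x 0 + side p.2 * x p.1.succ := by
  simp [centerOf, inner_add_left, EuclideanSpace.inner_single_left]

theorem firstOrder_centerOf_trivial (u v : EuclideanSpace ℝ (Fin (m + 1)))
    (hu : ⟪baseVector m, u⟫ = 0) (hv : ⟪baseVector m, v⟫ = 0)
    (h : ∀ p : Fin m × Fin 3, 0 ≤ firstOrder (baseVector m) (centerOf p) (u, v)) :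
    u = 0 ∧ v = 0 := by
  rw [inner_baseVector] at hu hv
  have key : ∀ j : Fin m, u j.succ = 0 ∧ v j.succ = 0 := by
    intro j
    have h0 := h (j, 0)
    have h1 := h (j, 1)
    have h2 := h (j, 2)
    simp only [firstOrder, inner_centerOf, inner_baseVector, centerOf_zero, hu, hv, height_eq,
      side] at h0 h1 h2
    norm_num [Matrix.cons_val_two] at h0 h1 h2
    -- The three constraints bound `f z = u j.succ + z * v j.succ` with signs `+, -, +`. As the
    -- middle value is the mean of the outer two, all three vanish.
    have hv0 : v j.succ = 0 := by linarith
    rw [hv0] at h0 h1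
    exact ⟨by linarith, hv0⟩
  constructor <;> ext i <;> refine Fin.cases ?_ (fun j => ?_) i
  · exact hu
  · exact (key j).1
  · exact hv
  · exact (key j).2

theorem isTangentBall_centerOf (p : Fin m × Fin 3) :
    IsTangentBall (centerOf p) 1 (axis (baseVector m) (norm_baseVector m)) := by
  refine ⟨one_pos, le_antisymm ?_ ?_⟩
  · refine (infDist_axis_le _).trans_eq ?_
    rw [inner_baseVector, centerOf_zero]
    have : centerOf p - height p • baseVector m = EuclideanSpace.single p.1.succ (side p.2) := by
      ext i
      simp [centerOf, baseVector]
    rw [this, PiLp.norm_single, Real.norm_eq_abs]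
    have := side_sq p.2
    rw [← abs_mul_abs_self] at this
    nlinarith [abs_nonneg (side p.2)]
  · refine (Metric.le_infDist ⟨_, mem_axis.2 ⟨0, rfl⟩⟩).2 fun q hq => ?_
    obtain ⟨t, rfl⟩ := mem_axis.1 hq
    rw [dist_eq_norm]
    have h1 := PiLp.norm_apply_le (centerOf p - t • baseVector m) p.1.succ
    have h2 : (centerOf p - t • baseVector m) p.1.succ = side p.2 := by
      simp [centerOf, baseVector]
    rw [h2, Real.norm_eq_abs] at h1
    have := side_sq p.2
    rw [← abs_mul_abs_self] at this
    nlinarith [abs_nonneg (side p.2)]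

theorem disjoint_closedBall_centerOf {p q : Fin m × Fin 3} (h : p ≠ q) :
    Disjoint (Metric.closedBall (centerOf p) 1) (Metric.closedBall (centerOf q) 1) := by
  apply Metric.closedBall_disjoint_closedBall
  have h1 := PiLp.norm_apply_le (centerOf p - centerOf q) 0
  rw [← dist_eq_norm, PiLp.sub_apply, centerOf_zero, centerOf_zero, height, height, ← mul_sub,
    norm_mul, Real.norm_eq_abs, Real.norm_eq_abs] at h1
  have hne : ((finProdFinEquiv p : Fin (m * 3)) : ℕ) ≠ ((finProdFinEquiv q : Fin (m * 3)) : ℕ) :=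
    fun h' => h (finProdFinEquiv.injective (Fin.ext h'))
  have h2 : (1 : ℝ) ≤ |((finProdFinEquiv p : Fin (m * 3)) : ℕ) -
      (((finProdFinEquiv q : Fin (m * 3)) : ℕ) : ℝ)| := by
    have : (1 : ℤ) ≤ |(((finProdFinEquiv p : Fin (m * 3)) : ℕ) : ℤ) -
      (((finProdFinEquiv q : Fin (m * 3)) : ℕ) : ℤ)| := by
      exact Int.one_le_abs (by omega)
    exact_mod_cast this
  -- Heights of distinct centers differ by at least `3`, more than the sum `2` of the radii.
  rw [abs_of_pos (by norm_num : (0 : ℝ) < 3)] at h1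
  linarith

end Configuration

theorem exists_isStablePinning (m : ℕ) :
    IsStablePinning (fun i : Fin (m * 3) => centerOf (finProdFinEquiv.symm i)) (fun _ => 1)
      (axis (baseVector m) (norm_baseVector m)) := by
  obtain ⟨ε, hε, κ, hκ, hstab⟩ := exists_uniform_firstOrder_lt (baseVector m)
    (fun i : Fin (m * 3) => centerOf (finProdFinEquiv.symm i)) (fun u v hu hv h =>
      firstOrder_centerOf_trivial u v hu hv fun p => by simpa using h (finProdFinEquiv p))
  -- The unperturbed family is covered as well, so this gives both pinning and stability.
  have hpins : ∀ (c' : Fin (m * 3) → EuclideanSpace ℝ (Fin (m + 1))) (r' : Fin (m * 3) → ℝ),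
      (∀ i, dist (c' i) (centerOf (finProdFinEquiv.symm i)) ≤ ε ∧
        IsTangentBall (c' i) (r' i) (axis (baseVector m) (norm_baseVector m))) →
      Pins (fun i => Metric.closedBall (c' i) (r' i)) (axis (baseVector m) (norm_baseVector m)) :=
    fun c' r' h => pins_axis_of_firstOrder _ c' r' (fun i => (h i).2) hκ
      (hstab c' fun i => (h i).1)
  exact
    { disjoint := fun i j hij => disjoint_closedBall_centerOf (finProdFinEquiv.symm.injective.ne hij)
      tangent := fun i => isTangentBall_centerOf _
      pins := hpins _ _ fun i => ⟨by simpa using hε.le, isTangentBall_centerOf _⟩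
      stable := ⟨ε, hε, hpins⟩ }

end Pinning

theorem theorem4 (d : ℕ) (hd : 2 ≤ d) :
    ∃ (n : ℕ) (c : Fin n → EuclideanSpace ℝ (Fin d)) (r : ℝ) (l : Pinning.Line d),
      Pinning.IsStablePinning c (fun _ => r) l := by
  obtain ⟨m, rfl⟩ : ∃ m, d = m + 1 := ⟨d - 1, by omega⟩
  exact ⟨m * 3, _, 1, _, Pinning.exists_isStablePinning m⟩
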